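/- Let $X$ be a locally convex Hausdorff space over $\mathbb{C}$ which is - *locally complete*: for each closed, bounded, absolutely convex $B\subseteq X$, the linear span of $B$ with the Minkowski functional of $B$ as norm is a Banach space with closed unit ball $B$; - *webbed*: there are absolutely convex sets $C_{n_1,\dots,n_k}\subseteq X$ ($k\ge 1$, $n_i\in\mathbb{N}$) with $X=\bigcup_n C_n$ and $C_{n_1,\dots,n_k}=\bigcup_n C_{n_1,\dots,n_k,n}$, such that for each sequence $(n_k)$ in $\mathbb{N}$ there are $\rho_k>0$ for which $\sum_k \rho_k x_k$ converges in $X$ whenever $x_k\in C_{n_1,\dots,n_k}$ for all $k$; - *ultrabornological*: $X$ is an inductive limit of Banach spaces, that is, it carries the finest locally convex topology making all members of some family of linear maps from Banach spaces into $X$ continuous, the ranges of which span $X$. Let $\mathcal{L}(X)$ be the algebra of continuous linear operators on $X$, and $\mathcal{L}_b(X)$ this space with the topology of uniform convergence on bounded sets. Let $T\in\mathcal{L}(X)$ be compact (some neighbourhood of $0$ has relatively compact image under $T$), and let $\sigma(T;X)$ be the set of those $\lambda\in\mathbb{C}$ for which $\lambda I-T$ has no inverse in $\mathcal{L}(X)$.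 Suppose that $1\in\sigma(T;X)$, that there is $\delta\in(0,1)$ with $\sigma(T;X)\setminus\{1\}\subseteq\{z\in\mathbb{C}:|z|\le\delta\}$, and that $$\operatorname{Ker}(I-T)\cap (I-T)(X)=\{0\}.$$ Then $T$ is power bounded, i.e. $\{T^n:n\in\mathbb{N}\}$ is equicontinuous, and uniformly mean ergodic, i.e. the averages $\frac1n\sum_{m=1}^n T^m$ converge in $\mathcal{L}_b(X)$ as $n\to\infty$. Moreover, there is a continuous linear projection $P\in\mathcal{L}(X)$ with range $\operatorname{Ker}(I-T)$ and kernel $(I-T)(X)$, and $T^n\to P$ in $\mathcal{L}_b(X)$ as $n\to\infty$. -/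

import Mathlib

open Filter Topology

universe u

/-- A (nonempty) absolutely convex subset of a complex vector space. -/
structure IsAbsConvexSet {X : Type u} [AddCommGroup X] [Module ℂ X] (B : Set X) : Prop where
  nonempty : B.Nonempty
  balanced : Balanced ℂ B
  convex : Convex ℝ B

namespace IsAbsConvexSet

open scoped Pointwise

variable {X : Type u} [AddCommGroup X] [Module ℂ X] {B : Set X}

theorem zero_mem (hB : IsAbsConvexSet B) : (0 : X) ∈ B :=
  hB.balanced.zero_mem hB.nonempty

theorem exists_pos_mem_smul (hB : IsAbsConvexSet B) {x : X} (hx : x ∈ Submodule.span ℂ B) :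
    ∃ r : ℝ, 0 < r ∧ x ∈ r • B := by
  induction hx using Submodule.span_induction with
  | mem x hx => exact ⟨1, one_pos, by simpa using hx⟩
  | zero => exact ⟨1, one_pos, by simpa using hB.zero_mem⟩
  | add x y _ _ hx hy =>
    obtain ⟨r, hr, hxr⟩ := hx
    obtain ⟨s, hs, hys⟩ := hy
    refine ⟨r + s, add_pos hr hs, ?_⟩
    rw [hB.convex.add_smul hr.le hs.le]
    exact Set.add_mem_add hxr hys
  | smul a x _ hx =>
    obtain ⟨r, hr, b, hb, rfl⟩ := hx
    have hpos : 0 < ‖a‖ + 1 := by positivity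
    refine ⟨(‖a‖ + 1) * r, mul_pos hpos hr, (a / ((‖a‖ + 1 : ℝ) : ℂ)) • b, ?_, ?_⟩
    · refine hB.balanced.smul_mem ?_ hb
      rw [norm_div, Complex.norm_real, Real.norm_of_nonneg hpos.le, div_le_one hpos]
      linarith
    · have hne : (((‖a‖ + 1 : ℝ)) : ℂ) ≠ 0 := by exact_mod_cast hpos.ne'
      simp only [← Complex.coe_smul, smul_smul, Complex.ofReal_mul]
      congr 1
      field_simp

/-- The absolutely convex set `B`, seen as a subset of its linear span. -/
abbrev inSpan (B : Set X) : Set (Submodule.span ℂ B) := Subtype.val ⁻¹' B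

theorem balanced_inSpan (hB : IsAbsConvexSet B) : Balanced ℂ (inSpan B) := by
  rw [balanced_iff_smul_mem]
  intro a ha x hx
  exact hB.balanced.smul_mem ha hx

theorem convex_inSpan (hB : IsAbsConvexSet B) : Convex ℝ (inSpan B) := by
  intro x hx y hy a b ha hb hab
  exact hB.convex hx hy ha hb hab

theorem absorbent_inSpan (hB : IsAbsConvexSet B) : Absorbent ℝ (inSpan B) := by
  intro x
  obtain ⟨r, hr, b, hb, hbx⟩ := hB.exists_pos_mem_smul x.2
  have hbal : Balanced ℝ (inSpan B) := by
    rw [balanced_iff_smul_mem]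
    intro a ha y hy
    exact hB.balanced_inSpan.smul_mem (a := (a : ℂ)) (by simpa using ha) hy
  have hx : x ∈ r • inSpan B :=
    ⟨⟨b, Submodule.subset_span hb⟩, hb, Subtype.ext hbx⟩
  refine Absorbs.of_norm ⟨r, fun c hc => ?_⟩
  rw [Set.singleton_subset_iff]
  exact hbal.smul_mono (by rwa [Real.norm_of_nonneg hr.le]) hx

/-- The Minkowski functional of an absolutely convex set `B` on the linear span of `B`. -/
noncomputable def minkowski (hB : IsAbsConvexSet B) : Seminorm ℂ (Submodule.span ℂ B) :=
  gaugeSeminorm hB.balanced_inSpan hB.convex_inSpan hB.absorbent_inSpan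

end IsAbsConvexSet

/-- `X` is locally complete: for each closed, bounded, absolutely convex `B`, the span of `B` is
complete for the uniformity of the Minkowski functional of `B`. For `X` Hausdorff and such `B` the
Minkowski functional is automatically a norm on the span and `B` is its closed unit ball, so that
this says that the span is a Banach space with closed unit ball `B`. -/
def IsLocallyComplete (X : Type u) [AddCommGroup X] [Module ℂ X] [TopologicalSpace X] : Prop :=
  ∀ (B : Set X) (hB : IsAbsConvexSet B), IsClosed B → Bornology.IsVonNBounded ℂ B →
    @CompleteSpace (Submodule.span ℂ B)
      hB.minkowski.toAddGroupSeminorm.toSeminormedAddCommGroup.toUniformSpace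

/-- A completing web (De Wilde) on `X`: absolutely convex sets `C [n₁, …, n_k]`, `k ≥ 1`, with
`X = ⋃ₙ C [n]` and `C [n₁, …, n_k] = ⋃ₙ C [n₁, …, n_k, n]` (the first equation is the second one
for the convention `C [] = X`), such that for each sequence `n₁, n₂, …` there are `ρ_k > 0` for
which `∑ ρ_k x_k` converges in `X` whenever `x_k ∈ C [n₁, …, n_k]` for all `k`. The entry
`n (k)` of the sequence is counted from `0`. -/
structure IsWeb {X : Type u} [AddCommGroup X] [Module ℂ X] [TopologicalSpace X]
    (C : List ℕ → Set X) : Prop where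
  nil : C [] = Set.univ
  absConvex : ∀ s, IsAbsConvexSet (C s)
  iUnion : ∀ s, C s = ⋃ n : ℕ, C (s ++ [n])
  completing : ∀ n : ℕ → ℕ, ∃ ρ : ℕ → ℝ, (∀ k, 0 < ρ k) ∧
    ∀ x : ℕ → X, (∀ k, x k ∈ C ((List.range (k + 1)).map n)) →
      ∃ y : X, Tendsto (fun N => ∑ k ∈ Finset.range N, ρ k • x k) atTop (𝓝 y)

/-- `X` is a webbed space. -/
def IsWebbed (X : Type u) [AddCommGroup X] [Module ℂ X] [TopologicalSpace X] : Prop :=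
  ∃ C : List ℕ → Set X, IsWeb C

/-- The locally convex topology `t` of `X` is the inductive topology with respect to the linear
maps `j i` from the normed spaces `E i`, whose ranges span `X`: it makes every `j i` continuous,
and it is finer than every locally convex vector space topology on `X` that does so. -/
structure IsInductiveLimit {X : Type u} [AddCommGroup X] [Module ℂ X] [t : TopologicalSpace X]
    {ι : Type u} (E : ι → Type u) [∀ i, NormedAddCommGroup (E i)] [∀ i, NormedSpace ℂ (E i)]
    (j : ∀ i, E i →ₗ[ℂ] X) : Prop where
  span : ⨆ i, LinearMap.range (j i) = ⊤
  continuous : ∀ i, Continuous (j i)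
  finest : ∀ t' : TopologicalSpace X, @IsTopologicalAddGroup X t' _ →
    @ContinuousSMul ℂ X _ _ t' → @LocallyConvexSpace ℝ X _ _ _ _ t' →
    (∀ i, @Continuous (E i) X _ t' (j i)) → t ≤ t'

/-- `X` is ultrabornological: an inductive limit of Banach spaces. -/
def IsUltrabornological (X : Type u) [AddCommGroup X] [Module ℂ X] [TopologicalSpace X] : Prop :=
  ∃ (ι : Type u) (E : ι → Type u) (_ : ∀ i, NormedAddCommGroup (E i))
    (_ : ∀ i, NormedSpace ℂ (E i)) (_ : ∀ i, CompleteSpace (E i)) (j : ∀ i, E i →ₗ[ℂ] X),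
    IsInductiveLimit E j

section Operators

variable {X : Type u} [AddCommGroup X] [Module ℂ X] [UniformSpace X] [IsUniformAddGroup X]
  [ContinuousSMul ℂ X]

/-- `T` is power bounded: its iterates form an equicontinuous family. -/
def IsPowerBounded (T : X →L[ℂ] X) : Prop :=
  Equicontinuous (fun (n : ℕ) (x : X) => (T ^ n) x)

/-- The Cesàro means `T_[n] = (1/n) (T + T² + ⋯ + Tⁿ)`, `n ≥ 1`. -/
noncomputable def cesaroMean (T : X →L[ℂ] X) (n : ℕ) : X →L[ℂ] X :=
  (n : ℂ)⁻¹ • ∑ m ∈ Finset.Icc 1 n, T ^ m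

/-- `T` is uniformly mean ergodic: its Cesàro means converge uniformly on bounded sets (this is
the topology that `X →L[ℂ] X` carries). -/
def IsUniformlyMeanErgodic (T : X →L[ℂ] X) : Prop :=
  ∃ Q : X →L[ℂ] X, Tendsto (cesaroMean T) atTop (𝓝 Q)

end Operators

/-! A compact `T` maps a neighbourhood of `0` into a compact balanced `K`. Local completeness makes
the span `Y` of the closed absolutely convex hull of `K` a Banach space, and `T = j ∘ S` with `S : X
→ Y` and `j : Y → X` continuous (`IsLocallyComplete.exists_compact_factorization`). The swapped
product `A = S ∘ j` is compact on `Y`, inherits the kernel condition, and has the same spectral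
bound, since its nonzero spectrum lies in that of `T`. On `Y`, Riesz theory gives a projection `P`
onto `Ker (1 - A)` along the range such that `A - P` has spectral radius `< 1`, so `A ^ n → P`
(`IsCompactOperator.exists_tendsto_pow`). Everything returns to `X` through `T ^ (n + 1) = j ∘ A ^ n
∘ S`, and the limit is `j ∘ P ∘ S`. -/

open scoped ENNReal NNReal in
theorem tendsto_pow_of_spectralRadius_lt_one {R : Type*} [NormedRing R] [NormedAlgebra ℂ R]
    [CompleteSpace R] {a : R} (ha : spectralRadius ℂ a < 1) :
    Tendsto (fun n : ℕ => a ^ n) atTop (𝓝 0) := by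
  obtain ⟨r, hr, hr1⟩ := ENNReal.lt_iff_exists_nnreal_btwn.1 ha
  have hr1' : r < 1 := by exact_mod_cast hr1
  have hev := (spectrum.pow_nnnorm_pow_one_div_tendsto_nhds_spectralRadius a).eventually_lt_const hr
  refine squeeze_zero_norm' (a := fun n : ℕ => (r : ℝ) ^ n) ?_
    (tendsto_pow_atTop_nhds_zero_of_lt_one r.2 (by exact_mod_cast hr1'))
  filter_upwards [hev, eventually_gt_atTop 0] with n hn hn0
  have h := (ENNReal.rpow_lt_rpow hn (Nat.cast_pos.2 hn0 : (0 : ℝ) < n)).le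
  rw [← ENNReal.rpow_mul, one_div, inv_mul_cancel₀ (Nat.cast_pos.2 hn0 : (0 : ℝ) < n).ne',
    ENNReal.rpow_one, ENNReal.rpow_natCast] at h
  exact_mod_cast h

/-! ### Riesz theory of a compact operator on a Banach space -/

section Banach

variable {Y : Type*} [NormedAddCommGroup Y] [NormedSpace ℂ Y]

/-- On the closed kernel `A` is the identity, which is therefore compact. -/
theorem IsCompactOperator.finiteDimensional_ker_one_sub {A : Y →L[ℂ] Y}
    (hA : IsCompactOperator A) :
    FiniteDimensional ℂ (LinearMap.ker (1 - A : Y →L[ℂ] Y).toLinearMap) := by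
  set N := LinearMap.ker (1 - A : Y →L[ℂ] Y).toLinearMap with hN
  have hAN : ∀ v ∈ N, A v = v := fun v hv => (sub_eq_zero.1 hv).symm
  have hclosed : IsClosed (N : Set Y) := (1 - A : Y →L[ℂ] Y).isClosed_ker
  have hmap : ∀ v ∈ N, A.toLinearMap v ∈ N := fun v hv => by
    simpa [hAN v hv] using hv
  have h := IsCompactOperator.restrict (f := A.toLinearMap) hA hmap hclosed
  refine FiniteDimensional.of_isCompactOperator_id ?_
  convert! h using 1
  ext v
  exact (hAN v v.2).symm

/-- The Riesz projection of a compact operator `A` at the eigenvalue `1`, when `1` is a pole of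
order at most one of the resolvent. -/
theorem IsCompactOperator.exists_projection [CompleteSpace Y] {A : Y →L[ℂ] Y} (hA : IsCompactOperator A)
    (hker : LinearMap.ker (1 - A : Y →L[ℂ] Y).toLinearMap ⊓
      LinearMap.range (1 - A : Y →L[ℂ] Y).toLinearMap = ⊥) :
    ∃ P : Y →L[ℂ] Y, IsCompactOperator P ∧ A * P = P ∧ P * A = P ∧ P * P = P ∧
      (∀ y, A y = y → P y = y) ∧ ∀ y, P y = 0 → ∃ z, y = z - A z := by
  have hfin := hA.finiteDimensional_ker_one_sub
  set N := LinearMap.ker (1 - A : Y →L[ℂ] Y).toLinearMap with hN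
  have hAN : ∀ v, v ∈ N ↔ A v = v := fun v => by
    rw [eq_comm, ← sub_eq_zero]; rfl
  have hdisj : ∀ v w, A v = v → v = w - A w → v = 0 := fun v w hv hw => by
    have : v ∈ N ⊓ LinearMap.range (1 - A : Y →L[ℂ] Y).toLinearMap :=
      ⟨(hAN v).2 hv, w, by simp [hw]⟩
    rwa [hker, Submodule.mem_bot] at this
  -- `Q` is an arbitrary continuous projection onto `N`; its kernel need not be the range of `1 -
  -- A`. Inverting `1 - A + Q` corrects this.
  obtain ⟨q, hq⟩ := Submodule.ClosedComplemented.of_finiteDimensional N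
  set Q : Y →L[ℂ] Y := N.subtypeL ∘L q with hQ
  have hQN : ∀ y, A (Q y) = Q y := fun y => (hAN _).1 (q y).2
  have hQid : ∀ y, A y = y → Q y = y := fun y hy => by
    exact congrArg Subtype.val (hq ⟨y, (hAN y).2 hy⟩)
  have hQc : IsCompactOperator Q := by
    have : LocallyCompactSpace N := .of_finiteDimensional_of_complete ℂ N
    exact (isCompactOperator_of_locallyCompactSpace_rng N.subtypeL).comp_clm q
  have hC : IsCompactOperator (A - Q) := hA.sub hQc
  -- Fredholm alternative: only injectivity is needed. If `A y - Q y = y`, then `Q y` lies in both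
  -- kernel and range of `1 - A`, so `Q y = 0`, whence `A y = y` and `y = Q y = 0`.
  have hunit : IsUnit (1 - (A - Q)) := by
    have h := (hC.hasEigenvalue_or_mem_resolventSet (one_ne_zero (α := ℂ))).resolve_left ?_
    · simpa [spectrum.mem_resolventSet_iff] using h
    · intro h
      obtain ⟨y, hy⟩ := h.exists_hasEigenvector
      refine hy.2 ?_
      have h1 : A y - Q y = y := by simpa using hy.apply_eq_smul
      have h2 : Q y = 0 := hdisj (Q y) (-y) (hQN y) (by
        rw [map_neg, ← sub_eq_zero]; nth_rw 2 [← h1]; abel)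
      rw [h2, sub_zero] at h1
      rw [← hQid y h1, h2]
  obtain ⟨⟨F, G, hFG, hGF⟩, hF⟩ := hunit
  simp only at hF
  subst hF
  -- This splits `z` along range and kernel of `1 - A`; so `Q * G` is the required projection.
  have hdec : ∀ z, z = (G z - A (G z)) + Q (G z) := fun z => by
    have : G z - (A (G z) - Q (G z)) = z := congrArg (fun L : Y →L[ℂ] Y => L z) hFG
    nth_rw 1 [← this]; abel
  have hPA : ∀ y, Q (G (A y)) = Q (G y) := fun y => by
    have h := hdec (y - A y)
    have h0 : Q (G (y - A y)) = 0 := hdisj _ (y - G (y - A y)) (hQN _) (by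
      rw [map_sub A]
      rw [← sub_eq_iff_eq_add'] at h
      rw [← h]; abel)
    rw [map_sub, map_sub, sub_eq_zero] at h0
    exact h0.symm
  have hid : ∀ y, A y = y → Q (G y) = y := fun y hy => by
    have h := hdec y
    have h0 : y - Q (G y) = 0 := hdisj _ (G y) (by rw [map_sub, hy, hQN])
      (sub_eq_iff_eq_add.2 h)
    exact (sub_eq_zero.1 h0).symm
  refine ⟨Q * G, hQc.comp_clm G, ?_, ?_, ?_, hid, fun y hy => ⟨G y, ?_⟩⟩
  · ext y; exact hQN _
  · ext y; exact hPA y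
  · ext y; exact hid _ (hQN _)
  · have h := hdec y
    rwa [show Q (G y) = 0 from hy, add_zero] at h

/-- An eigenvector of `A - P` for `μ ≠ 0` is killed by `P`, so it is an eigenvector of `A` with `μ ≠
1`. Hence `A - P` has spectral radius at most `δ`. -/
theorem IsCompactOperator.exists_tendsto_pow [CompleteSpace Y] {A : Y →L[ℂ] Y} (hA : IsCompactOperator A)
    {δ : ℝ} (hδ0 : 0 < δ) (hδ1 : δ < 1)
    (hσ : spectrum ℂ A \ {1} ⊆ Metric.closedBall (0 : ℂ) δ)
    (hker : LinearMap.ker (1 - A : Y →L[ℂ] Y).toLinearMap ⊓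
      LinearMap.range (1 - A : Y →L[ℂ] Y).toLinearMap = ⊥) :
    ∃ P : Y →L[ℂ] Y, A * P = P ∧ P * A = P ∧ (∀ y, P y = 0 → ∃ z, y = z - A z) ∧
      Tendsto (fun n : ℕ => A ^ n) atTop (𝓝 P) := by
  obtain ⟨P, hPc, hAP, hPA, hPP, hid, hkerP⟩ := hA.exists_projection hker
  refine ⟨P, hAP, hPA, hkerP, ?_⟩
  -- Exponent `0` must be excluded: there the two sides would be `1` and `1 - P`.
  have hpow : ∀ n : ℕ, (A - P) ^ (n + 1) = A ^ (n + 1) - P := fun n => by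
    have hAn : ∀ m : ℕ, A ^ m * P = P := fun m => by
      induction m with
      | zero => simp
      | succ m ih => rw [pow_succ, mul_assoc, hAP, ih]
    induction n with
    | zero => simp
    | succ n ih =>
      rw [pow_succ, ih, sub_mul, mul_sub, mul_sub, hAn, hPA, hPP, sub_self, sub_zero, ← pow_succ]
  have hrad : spectralRadius ℂ (A - P) < 1 := by
    refine lt_of_le_of_lt (b := (δ.toNNReal : ENNReal)) (iSup₂_le fun μ hμ => ?_)
      (by exact_mod_cast Real.toNNReal_lt_one.2 hδ1)
    rw [ENNReal.coe_le_coe, Real.le_toNNReal_iff_coe_le hδ0.le, coe_nnnorm]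
    rcases eq_or_ne μ 0 with rfl | hμ0
    · simpa using hδ0.le
    have hev := ((hA.sub hPc).hasEigenvalue_iff_mem_spectrum (T := A - P) hμ0).2 hμ
    obtain ⟨y, hy⟩ := hev.exists_hasEigenvector
    have hy1 : A y - P y = μ • y := by simpa using hy.apply_eq_smul
    have hPy : P y = 0 := by
      have h := congrArg P hy1
      rw [map_sub, map_smul, show P (A y) = P y from congrArg (fun L : Y →L[ℂ] Y => L y) hPA,
        show P (P y) = P y from congrArg (fun L : Y →L[ℂ] Y => L y) hPP, sub_self] at h
      exact (smul_eq_zero.1 h.symm).resolve_left hμ0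
    rw [hPy, sub_zero] at hy1
    have hmem : μ ∈ spectrum ℂ A := (hA.hasEigenvalue_iff_mem_spectrum hμ0).1
      (Module.End.hasEigenvalue_of_hasEigenvector
        (Module.End.hasEigenvector_iff.2 ⟨Module.End.mem_eigenspace_iff.2 hy1, hy.2⟩))
    have hμ1 : μ ≠ 1 := by
      rintro rfl
      exact hy.2 (by rw [← hid y (by simpa using hy1), hPy])
    simpa using hσ ⟨hmem, hμ1⟩
  have h := ((tendsto_pow_of_spectralRadius_lt_one hrad).comp (tendsto_add_atTop_nat 1)).add_const P
  rw [zero_add] at h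
  refine (tendsto_add_atTop_iff_nat 1).1 (h.congr fun n => ?_)
  simp [hpow]

end Banach

/-! ### Transfer between `T = j ∘ S` and `S ∘ j` -/

section Factorization

variable {X : Type u} [AddCommGroup X] [Module ℂ X] [UniformSpace X] [IsUniformAddGroup X]
  {Y : Type*} [NormedAddCommGroup Y] [NormedSpace ℂ Y]
  {T : X →L[ℂ] X} {j : Y →L[ℂ] X} {S : X →L[ℂ] Y}

theorem pow_succ_eq_comp_pow_comp (hjS : j ∘L S = T) (n : ℕ) :
    T ^ (n + 1) = j ∘L ((S ∘L j) ^ n) ∘L S := by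
  subst hjS
  induction n with
  | zero => ext x; simp
  | succ n ih => rw [pow_succ, ih, pow_succ]; rfl

theorem equicontinuous_pow_of_factorization (hjS : j ∘L S = T) {P : Y →L[ℂ] Y}
    (hP : Tendsto (fun n : ℕ => (S ∘L j) ^ n) atTop (𝓝 P)) : IsPowerBounded T := by
  obtain ⟨M, hM⟩ := (Metric.isBounded_range_of_tendsto _ hP).exists_norm_le
  refine equicontinuous_of_equicontinuousAt_zero (hom := X →L[ℂ] X) (fun n : ℕ => T ^ n) ?_
  intro U hU
  rw [uniformity_eq_comap_nhds_zero X] at hU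
  obtain ⟨V, hV, hVU⟩ := hU
  obtain ⟨r, hr, hrV⟩ := Metric.mem_nhds_iff.1
    (j.continuous.tendsto' 0 0 (map_zero j) hV)
  have hM' : 0 < |M| + 1 := by positivity
  have hSr : ∀ᶠ x in 𝓝 (0 : X), ‖S x‖ < r / (|M| + 1) :=
    (S.continuous.norm.tendsto' 0 0 (by simp)).eventually_lt_const (div_pos hr hM')
  filter_upwards [hSr, hV] with x hx hxV n
  refine hVU ?_
  simp only [Function.comp_apply, map_zero, sub_zero, Set.mem_preimage]
  cases n with
  | zero => simpa using hxV
  | succ n =>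
    rw [pow_succ_eq_comp_pow_comp hjS]
    refine hrV ?_
    rw [mem_ball_zero_iff]
    calc ‖((S ∘L j) ^ n) (S x)‖ ≤ ‖(S ∘L j) ^ n‖ * ‖S x‖ := ContinuousLinearMap.le_opNorm _ _
      _ ≤ (|M| + 1) * ‖S x‖ := by
        gcongr
        exact ((hM _ ⟨n, rfl⟩).trans (le_abs_self M)).trans (by linarith)
      _ < (|M| + 1) * (r / (|M| + 1)) := by gcongr
      _ = r := mul_div_cancel₀ r hM'.ne'

variable [ContinuousSMul ℂ X]

/-- Jacobson's identity: if `G` inverts `μ - j S`, then `μ⁻¹ (1 + S G j)` inverts `μ - S j`. -/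
theorem spectrum_comp_diff_zero_subset (hjS : j ∘L S = T) {μ : ℂ} (hμ : μ ≠ 0)
    (h : μ ∈ spectrum ℂ (S ∘L j)) : μ ∈ spectrum ℂ T := by
  contrapose! h
  rw [spectrum.notMem_iff] at h ⊢
  obtain ⟨⟨F, G, hFG, hGF⟩, hF⟩ := h
  simp only at hF
  subst hF hjS
  have h1 : ∀ x, μ • G x - j (S (G x)) = x := fun x => by
    simpa [Algebra.algebraMap_eq_smul_one] using congrArg (fun L : X →L[ℂ] X => L x) hFG
  have h2 : ∀ x, μ • G x - G (j (S x)) = x := fun x => by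
    have h : G (μ • x - j (S x)) = x := by
      simpa [Algebra.algebraMap_eq_smul_one] using congrArg (fun L : X →L[ℂ] X => L x) hGF
    rwa [map_sub, map_smul] at h
  refine ⟨⟨_, μ⁻¹ • (1 + S ∘L G ∘L j), ?_, ?_⟩, rfl⟩
  · ext y
    have h := congrArg S (h1 (j y))
    rw [map_sub, map_smul, sub_eq_iff_eq_add', ← sub_eq_iff_eq_add] at h
    have : μ • μ⁻¹ • (y + S (G (j y))) - S (j (μ⁻¹ • (y + S (G (j y))))) = y := by
      rw [smul_inv_smul₀ hμ, map_smul, map_smul, map_add, map_add, ← h, add_sub_cancel,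
        smul_smul, inv_mul_cancel₀ hμ, one_smul, add_sub_cancel_right]
    simpa [Algebra.algebraMap_eq_smul_one] using this
  · ext y
    have h := congrArg S (h2 (j y))
    rw [map_sub, map_smul] at h
    have : μ⁻¹ • ((μ • y - S (j y)) + S (G (j (μ • y - S (j y))))) = y := by
      rw [map_sub, map_sub, map_sub, map_smul, map_smul, map_smul, h, sub_add_cancel,
        inv_smul_smul₀ hμ]
    simpa [Algebra.algebraMap_eq_smul_one] using this

theorem tendsto_comp_comp {ι : Type*} {l : Filter ι} {u : ι → Y →L[ℂ] Y} {P : Y →L[ℂ] Y}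
    (j : Y →L[ℂ] X) (S : X →L[ℂ] Y) (hu : Tendsto u l (𝓝 P)) :
    Tendsto (fun i => j ∘L (u i) ∘L S) l (𝓝 (j ∘L P ∘L S)) :=
  (((ContinuousLinearMap.postcomp X j).continuous.comp
    (ContinuousLinearMap.precomp Y S).continuous).tendsto P).comp hu

theorem tendsto_cesaroMean_of_factorization (hjS : j ∘L S = T) {P : Y →L[ℂ] Y}
    (hP : Tendsto (fun n : ℕ => (S ∘L j) ^ n) atTop (𝓝 P)) :
    Tendsto (cesaroMean T) atTop (𝓝 (j ∘L P ∘L S)) := by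
  refine (tendsto_comp_comp j S hP.cesaro_smul).congr fun n => ?_
  -- The index shift turns the exponents `1, …, n` of `T` into `0, …, n - 1` for `S ∘ j`, exactly
  -- those of the Cesàro means in Mathlib.
  have hsum : ∑ m ∈ Finset.Icc 1 n, T ^ m =
      ∑ m ∈ Finset.range n, j ∘L ((S ∘L j) ^ m) ∘L S := by
    rw [Finset.range_eq_Ico, ← Finset.Ico_add_one_right_eq_Icc,
      ← Finset.sum_Ico_add' (fun m => T ^ m) 0 n 1]
    exact Finset.sum_congr rfl fun m _ => pow_succ_eq_comp_pow_comp hjS m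
  rw [cesaroMean, hsum]
  ext x
  simp [map_sum, ← Complex.coe_smul]

theorem tendsto_pow_of_factorization (hjS : j ∘L S = T) {P : Y →L[ℂ] Y}
    (hP : Tendsto (fun n : ℕ => (S ∘L j) ^ n) atTop (𝓝 P)) :
    Tendsto (fun n : ℕ => T ^ n) atTop (𝓝 (j ∘L P ∘L S)) :=
  (tendsto_add_atTop_iff_nat 1).1
    ((tendsto_comp_comp j S hP).congr fun n => (pow_succ_eq_comp_pow_comp hjS n).symm)

theorem powerBounded_and_tendsto_pow_of_factorization [CompleteSpace Y] [T2Space X] (hjS : j ∘L S = T)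
    (hA : IsCompactOperator (S ∘L j)) {δ : ℝ} (hδ0 : 0 < δ) (hδ1 : δ < 1)
    (hσ : spectrum ℂ T \ {1} ⊆ Metric.closedBall (0 : ℂ) δ)
    (hker : LinearMap.ker (1 - T : X →L[ℂ] X).toLinearMap ⊓
      LinearMap.range (1 - T : X →L[ℂ] X).toLinearMap = ⊥) :
    IsPowerBounded T ∧ IsUniformlyMeanErgodic T ∧
      ∃ P : X →L[ℂ] X, IsIdempotentElem P ∧
        LinearMap.range P.toLinearMap = LinearMap.ker (1 - T : X →L[ℂ] X).toLinearMap ∧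
        LinearMap.ker P.toLinearMap = LinearMap.range (1 - T : X →L[ℂ] X).toLinearMap ∧
        Tendsto (fun n : ℕ => T ^ n) atTop (𝓝 P) := by
  have hT : ∀ x, T x = j (S x) := fun x => by rw [← hjS]; rfl
  obtain ⟨P, hAP, hPA, hkerP, hP⟩ := hA.exists_tendsto_pow hδ0 hδ1
    (fun μ hμ => by
      rcases eq_or_ne μ 0 with rfl | h0
      · simpa using hδ0.le
      · exact hσ ⟨spectrum_comp_diff_zero_subset hjS h0 hμ.1, hμ.2⟩)
    (by
      rw [eq_bot_iff]
      rintro y ⟨hy, z, rfl⟩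
      simp only [SetLike.mem_coe, LinearMap.mem_ker, ContinuousLinearMap.coe_coe,
        sub_apply, one_apply_eq_self,
        ContinuousLinearMap.comp_apply, sub_eq_zero] at hy ⊢
      -- `j` intertwines `1 - S j` with `1 - T`, so `j y = 0` for `y` in the intersection; then `y =
      -- S (j y) = 0`.
      have hmem : j (z - S (j z)) ∈ LinearMap.ker (1 - T : X →L[ℂ] X).toLinearMap ⊓
          LinearMap.range (1 - T : X →L[ℂ] X).toLinearMap :=
        ⟨by simpa [hT, sub_eq_zero] using congrArg j hy, j z, by simp [hT]⟩
      rw [hker, Submodule.mem_bot] at hmem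
      rw [hy, hmem, map_zero]
      exact Submodule.zero_mem _)
  have hAP' : ∀ y, S (j (P y)) = P y := fun y => congrArg (fun L : Y →L[ℂ] Y => L y) hAP
  have hPA' : ∀ y, P (S (j y)) = P y := fun y => congrArg (fun L : Y →L[ℂ] Y => L y) hPA
  have hid : ∀ x, T x = x → j (P (S x)) = x := fun x hx => by
    have hfix : ∀ n : ℕ, ((S ∘L j) ^ n) (S x) = S x := fun n => by
      induction n with
      | zero => rfl
      | succ n ih =>
        change ((S ∘L j) ^ n) (S (j (S x))) = S x
        rw [← hT, hx, ih]
    have h := ((ContinuousLinearMap.apply ℂ Y (S x)).continuous.tendsto P).comp hP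
    have : P (S x) = S x := tendsto_nhds_unique h (by simp [Function.comp_def, hfix])
    rw [this, ← hT, hx]
  refine ⟨equicontinuous_pow_of_factorization hjS hP,
    ⟨_, tendsto_cesaroMean_of_factorization hjS hP⟩,
    j ∘L P ∘L S, ?_, ?_, ?_, tendsto_pow_of_factorization hjS hP⟩
  · ext x
    exact hid _ (by simp [hT, hAP'])
  · ext x
    simp only [LinearMap.mem_range, LinearMap.mem_ker, ContinuousLinearMap.coe_coe,
      sub_apply, one_apply_eq_self,
      ContinuousLinearMap.comp_apply, sub_eq_zero]
    refine ⟨?_, fun hx => ⟨x, hid x hx.symm⟩⟩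
    rintro ⟨w, rfl⟩
    rw [hT, hAP']
  · ext x
    simp only [LinearMap.mem_range, LinearMap.mem_ker, ContinuousLinearMap.coe_coe,
      sub_apply, one_apply_eq_self,
      ContinuousLinearMap.comp_apply]
    constructor
    · intro hx
      obtain ⟨z, hz⟩ := hkerP (S x) (by rw [← hAP', hx, map_zero])
      -- Here `S x = z - S (j z)` gives `T x = (1 - T) (j z)`, and `x = (1 - T) x + T x`.
      refine ⟨x + j z, ?_⟩
      have : T x = j z - T (j z) := by rw [hT, hz, map_sub, hT]; rfl
      rw [map_add, this]; abel
    · rintro ⟨w, rfl⟩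
      rw [map_sub, map_sub, hT, hPA', sub_self, map_zero]

end Factorization

/-! ### The Banach space spanned by a closed bounded disc -/

section MinkowskiSpan

variable {X : Type u} [AddCommGroup X] [Module ℂ X]

namespace IsAbsConvexSet

variable {B : Set X}

theorem mem_of_minkowski_lt_one (hB : IsAbsConvexSet B) {x : Submodule.span ℂ B}
    (hx : hB.minkowski x < 1) : (x : X) ∈ B :=
  setOfPred_gauge_lt_one_subset_self hB.convex_inSpan hB.zero_mem hB.absorbent_inSpan hx

open scoped Pointwise in
theorem minkowski_le_of_mem_smul (hB : IsAbsConvexSet B) {x : Submodule.span ℂ B} {r : ℝ}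
    (hr : 0 ≤ r) (hx : (x : X) ∈ r • B) : hB.minkowski x ≤ r := by
  refine gauge_le_of_mem hr ?_
  obtain ⟨b, hb, hbx⟩ := hx
  exact ⟨⟨b, Submodule.subset_span hb⟩, hb, Subtype.ext hbx⟩

/-- Boundedness of `B` makes the Minkowski topology finer than that of `X`. This gives both
continuity of the inclusion and, for `X` separated, definiteness of the norm. -/
theorem exists_forall_minkowski_lt_mem [TopologicalSpace X] (hB : IsAbsConvexSet B)
    (hb : Bornology.IsVonNBounded ℂ B) {V : Set X} (hV : V ∈ 𝓝 0) :
    ∃ ε : ℝ, 0 < ε ∧ ∀ x : Submodule.span ℂ B, hB.minkowski x < ε → (x : X) ∈ V := by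
  obtain ⟨r, hr, hrV⟩ := (hb hV).exists_pos
  refine ⟨r⁻¹, inv_pos.2 hr, fun x hx => ?_⟩
  have hr0 : (r : ℂ) ≠ 0 := by exact_mod_cast hr.ne'
  have h1 : hB.minkowski ((r : ℂ) • x) < 1 := by
    rw [map_smul_eq_mul, Complex.norm_real, Real.norm_of_nonneg hr.le]
    calc r * hB.minkowski x < r * r⁻¹ := by gcongr
      _ = 1 := mul_inv_cancel₀ hr.ne'
  obtain ⟨v, hv, hvx⟩ := hrV r (by simp [abs_of_pos hr]) (hB.mem_of_minkowski_lt_one h1)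
  have : v = (x : X) := smul_right_injective X hr0 hvx
  exact this ▸ hv

end IsAbsConvexSet

/-- The linear span of `B`, without the topology inherited from the ambient space. -/
def MinkowskiSpan (B : Set X) : Type u := Submodule.span ℂ B

instance (B : Set X) : AddCommGroup (MinkowskiSpan B) :=
  inferInstanceAs (AddCommGroup (Submodule.span ℂ B))

instance (B : Set X) : Module ℂ (MinkowskiSpan B) :=
  inferInstanceAs (Module ℂ (Submodule.span ℂ B))

open scoped Pointwise in
theorem IsLocallyComplete.exists_banach_disc [TopologicalSpace X] [IsTopologicalAddGroup X]
    [T1Space X] (hlc : IsLocallyComplete X) {B : Set X} (hB : IsAbsConvexSet B)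
    (hcl : IsClosed B) (hb : Bornology.IsVonNBounded ℂ B) :
    ∃ (Y : Type u) (_ : NormedAddCommGroup Y) (_ : NormedSpace ℂ Y) (_ : CompleteSpace Y)
      (j : Y →L[ℂ] X), Function.Injective j ∧
        LinearMap.range j.toLinearMap = Submodule.span ℂ B ∧
        (∀ y, ‖y‖ < 1 → j y ∈ B) ∧ ∀ (y : Y) (r : ℝ), 0 ≤ r → j y ∈ r • B → ‖y‖ ≤ r := by
  let p : Seminorm ℂ (MinkowskiSpan B) := hB.minkowski
  let : SeminormedAddCommGroup (MinkowskiSpan B) :=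
    p.toAddGroupSeminorm.toSeminormedAddCommGroup
  have hsep : ∀ x : MinkowskiSpan B, ‖x‖ = 0 → x = 0 := fun x hx => by
    refine Subtype.ext (?_ : x.1 = 0)
    by_contra hne
    obtain ⟨ε, hε, h⟩ := hB.exists_forall_minkowski_lt_mem hb
      (isOpen_compl_singleton.mem_nhds (Ne.symm hne : (0 : X) ∈ ({x.1}ᶜ : Set X)))
    exact h x (lt_of_eq_of_lt hx hε) rfl
  let inst : NormedAddCommGroup (MinkowskiSpan B) := NormedAddCommGroup.ofSeparation hsep
  let inst' : NormedSpace ℂ (MinkowskiSpan B) :=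
    ⟨fun a x => (map_smul_eq_mul p a x).le⟩
  let jl : MinkowskiSpan B →ₗ[ℂ] X := (Submodule.span ℂ B).subtype
  have hj : Continuous jl := by
    refine continuous_of_continuousAt_zero jl ?_
    rw [ContinuousAt, map_zero]
    intro V hV
    obtain ⟨ε, hε, h⟩ := hB.exists_forall_minkowski_lt_mem hb hV
    exact Metric.mem_nhds_iff.2 ⟨ε, hε, fun y hy => h y (mem_ball_zero_iff.1 hy)⟩
  refine ⟨MinkowskiSpan B, inst, inst', hlc B hB hcl hb, ⟨jl, hj⟩, Subtype.val_injective,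
    Submodule.range_subtype _, fun y hy => hB.mem_of_minkowski_lt_one hy,
    fun y r hr hy => hB.minkowski_le_of_mem_smul hr hy⟩

end MinkowskiSpan

/-! ### Factoring a compact operator through a Banach space -/

section CompactOperator

variable {X : Type u} [AddCommGroup X] [Module ℂ X]

theorem Balanced.convexHull_real {s : Set X} (hs : Balanced ℂ s) :
    Balanced ℂ (convexHull ℝ s) := by
  intro a ha
  have h := (DistribSMul.toLinearMap ℝ X a).image_convexHull s
  rintro _ ⟨x, hx, rfl⟩
  have : a • x ∈ (DistribSMul.toLinearMap ℝ X a) '' convexHull ℝ s := ⟨x, hx, rfl⟩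
  rw [h] at this
  exact convexHull_mono (hs a ha) this

theorem IsCompact.exists_balanced_superset [TopologicalSpace X] [ContinuousSMul ℂ X] {K : Set X} (hK : IsCompact K) :
    ∃ K' : Set X, IsCompact K' ∧ Balanced ℂ K' ∧ K ⊆ K' := by
  refine ⟨(fun p : ℂ × X => p.1 • p.2) '' (Metric.closedBall 0 1 ×ˢ K),
    ((isCompact_closedBall 0 1).prod hK).image continuous_smul, ?_, fun x hx =>
      ⟨(1, x), ⟨by simp, hx⟩, one_smul _ _⟩⟩
  rintro a ha _ ⟨_, ⟨⟨b, x⟩, ⟨hb, hx⟩, rfl⟩, rfl⟩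
  refine ⟨(a * b, x), ⟨?_, hx⟩, mul_smul _ _ _⟩
  rw [mem_closedBall_zero_iff] at hb ⊢
  exact (norm_mul_le a b).trans (mul_le_one₀ ha (norm_nonneg _) hb)

open scoped Pointwise in
theorem IsLocallyComplete.exists_compact_factorization [UniformSpace X] [IsUniformAddGroup X]
    [ContinuousSMul ℂ X] [LocallyConvexSpace ℝ X] [T2Space X]
    (hlc : IsLocallyComplete X) {T : X →L[ℂ] X} (hT : IsCompactOperator T) :
    ∃ (Y : Type u) (_ : NormedAddCommGroup Y) (_ : NormedSpace ℂ Y) (_ : CompleteSpace Y)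
      (j : Y →L[ℂ] X) (S : X →L[ℂ] Y), j ∘L S = T ∧ IsCompactOperator (S ∘L j) := by
  obtain ⟨K₀, hK₀, hTK₀⟩ := hT
  obtain ⟨K, hK, hKb, hK₀K⟩ := hK₀.exists_balanced_superset
  have hTK : T ⁻¹' K ∈ 𝓝 0 := mem_of_superset hTK₀ (Set.preimage_mono hK₀K)
  have : ContinuousSMul ℝ X :=
    ⟨((Complex.continuous_ofReal.comp continuous_fst).smul continuous_snd :
      Continuous fun p : ℝ × X => (p.1 : ℂ) • p.2)⟩
  set B := closure (convexHull ℝ K)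
  have hKB : K ⊆ B := (subset_convexHull ℝ K).trans subset_closure
  have hB : IsAbsConvexSet B :=
    ⟨⟨T 0, hKB (show (0 : X) ∈ T ⁻¹' K from mem_of_mem_nhds hTK)⟩, hKb.convexHull_real.closure,
      (convex_convexHull ℝ K).closure⟩
  -- `B` itself need not be compact; total boundedness passes to the closed convex hull and
  -- suffices.
  have hBb : Bornology.IsVonNBounded ℂ B :=
    (hK.totallyBounded.convexHull.closure).isVonNBounded ℂ
  obtain ⟨Y, _, _, _, j, hinj, hrange, hball, hle⟩ :=
    hlc.exists_banach_disc hB isClosed_closure hBb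
  have hmem : ∀ x, T x ∈ LinearMap.range j.toLinearMap := fun x => by
    rw [hrange]
    obtain ⟨r, hr, hrV⟩ := (absorbent_nhds_zero (𝕜 := ℂ) hTK x).exists_pos
    obtain ⟨v, hv, hvx⟩ := hrV (r : ℂ) (by simp [abs_of_pos hr]) rfl
    rw [← hvx]
    simp only [map_smul]
    exact Submodule.smul_mem _ _ (Submodule.subset_span (hKB hv))
  let e := LinearEquiv.ofInjective j.toLinearMap hinj
  let Sl : X →ₗ[ℂ] Y := e.symm.toLinearMap ∘ₗ T.toLinearMap.codRestrict _ hmem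
  have hjS : ∀ x, j (Sl x) = T x := fun x =>
    congrArg Subtype.val (e.apply_symm_apply ⟨T x, hmem x⟩)
  have hS : Continuous Sl := by
    refine continuous_of_continuousAt_zero Sl ?_
    rw [ContinuousAt, map_zero]
    refine Metric.nhds_basis_closedBall.tendsto_right_iff.2 fun ε hε => ?_
    have hε0 : (ε : ℂ) ≠ 0 := by exact_mod_cast hε.ne'
    filter_upwards [(set_smul_mem_nhds_zero_iff hε0).2 hTK] with x hx
    rw [mem_closedBall_zero_iff]
    refine hle _ ε hε.le ?_
    obtain ⟨v, hv, rfl⟩ := hx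
    rw [hjS]
    exact ⟨T v, hKB hv, by simp⟩
  let S : X →L[ℂ] Y := ⟨Sl, hS⟩
  refine ⟨Y, _, _, ‹_›, j, S, ContinuousLinearMap.ext hjS, ?_⟩
  -- `S '' K` is compact in the complete space `Y`, so its closed convex hull is compact; by
  -- continuity of `S` it contains `S '' B`, hence the image of the open unit ball under `S ∘ j`.
  refine ⟨closure (convexHull ℝ (S '' K)),
    (hK.image S.continuous).totallyBounded.convexHull.closure.isCompact_of_isClosed
      isClosed_closure, ?_⟩
  filter_upwards [Metric.ball_mem_nhds (0 : Y) one_pos] with y hy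
  have hyB : S (j y) ∈ S '' B := ⟨j y, hball y (mem_ball_zero_iff.1 hy), rfl⟩
  have himage : S '' convexHull ℝ K = convexHull ℝ (S '' K) :=
    (S.toLinearMap.restrictScalars ℝ).image_convexHull K
  rw [← himage]
  exact image_closure_subset_closure_image S.continuous hyB

end CompactOperator

theorem theorem6p4 {X : Type u} [AddCommGroup X] [Module ℂ X] [UniformSpace X]
    [IsUniformAddGroup X] [ContinuousSMul ℂ X] [LocallyConvexSpace ℝ X] [T2Space X]
    (hlc : IsLocallyComplete X) (hweb : IsWebbed X) (hub : IsUltrabornological X)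
    (T : X →L[ℂ] X) (hT : IsCompactOperator T)
    (h1 : (1 : ℂ) ∈ spectrum ℂ T)
    (δ : ℝ) (hδ0 : 0 < δ) (hδ1 : δ < 1)
    (hσ : spectrum ℂ T \ {1} ⊆ Metric.closedBall (0 : ℂ) δ)
    (hker : LinearMap.ker (1 - T : X →L[ℂ] X).toLinearMap ⊓
      LinearMap.range (1 - T : X →L[ℂ] X).toLinearMap = ⊥) :
    IsPowerBounded T ∧ IsUniformlyMeanErgodic T ∧
      ∃ P : X →L[ℂ] X, IsIdempotentElem P ∧
        LinearMap.range P.toLinearMap = LinearMap.ker (1 - T : X →L[ℂ] X).toLinearMap ∧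
        LinearMap.ker P.toLinearMap = LinearMap.range (1 - T : X →L[ℂ] X).toLinearMap ∧
        Tendsto (fun n : ℕ => T ^ n) atTop (𝓝 P) := by
  obtain ⟨Y, _, _, _, j, S, hjS, hA⟩ := hlc.exists_compact_factorization hT
  exact powerBounded_and_tendsto_pow_of_factorization hjS hA hδ0 hδ1 hσ hker
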